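/- **Paths.** Let $\mathbb V$ be a set of router identifiers. A path is a finite sequence of contiguous edges in $\mathbb V\times\mathbb V$; it is simple if it visits no router twice. Let $\mathbb P$ be the set of simple paths, including the trivial (empty) path $[\,]$, together with an extra element $\bot$ (the invalid path). No router lies on $[\,]$ or $\bot$. An edge $(i,j)$ is aligned with $p\in\mathbb P\setminus\{\bot\}$ if $p=[\,]$ or $j$ is the origin of $p$; no edge is aligned with $\bot$. **Algebras.** A raw routing algebra $(S,\oplus,E,\overline 0,\overline\infty,f^\infty)$ consists of a set $S$, an operation $\oplus:S\times S\to S$, a set $E_{ij}$ of functions $S\to S$ for each $(i,j)\in\mathbb V\times\mathbb V$, elements $\overline 0,\overline\infty\in S$, and an element $f^\infty_{ij}\in E_{ij}$ for each $(i,j)$. It is a *routing algebra* if $\oplus$ is selective ($x\oplus y\in\{x,y\}$), associative and commutative, $\overline 0$ is an annihilator and $\overline\infty$ an identity for $\oplus$, $f(\overline\infty)=\overline\infty$ for all $f\in\bigcup_{i,j} E_{ij}$, and $f^\infty_{ij}(x)=\overline\infty$ for all $i,j,x$. It is a *path algebra*, when equipped with a function $path:S\to\mathbb P$, if (P1) $x=\overline\infty\iff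 path(x)=\bot$; (P2) $path(\overline 0)=[\,]$; (P3) for all $i,j$, $f\in E_{ij}$ and $x\in S$: $path(f(x))=\bot$ if $i$ lies on $path(x)$ or $(i,j)$ is not aligned with $path(x)$, and otherwise $path(f(x))$ is either $\bot$ or $(i,j)::path(x)$ (it is thus $\bot$ whenever $(i,j)::path(x)$ is not simple). It is *increasing* if $x\oplus f(x)=x$ for all $f\in\bigcup_{i,j} E_{ij}$ and $x\in S$. **Protocol.** Let $V\subseteq\mathbb V$ be finite; times and epochs are natural numbers. A network $N$ assigns to each epoch $e$ a matrix with entries $N^e_{ij}\in E_{ij}$ ($i,j\in V$). For $p\subseteq V$ let $A^{ep}_{ij}=N^e_{ij}$ if $i,j\in p$ and $A^{ep}_{ij}=f^\infty_{ij}$ otherwise. Let $I_{ij}=\overline 0$ if $i=j$ and $\overline\infty$ otherwise, and let $F_A(X)_{ij}=\big(\bigoplus_{k\in V}A_{ik}(X_{kj})\big)\oplus I_{ij}$ for $X\in S^{V\times V}$. A schedule $(\alpha,\beta,\eta,\pi)$ consists of $\alpha:\mathbb N\to 2^V$, $\beta:\mathbb N\times V\times V\to\mathbb N$, $\eta:\mathbb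 N\to\mathbb N$, $\pi:\mathbb N\to 2^V$ with $\beta(t+1,i,j)\le t$ and $\eta$ monotone; put $\rho(t)=\pi(\eta(t))$. The asynchronous state is $$\delta^t_{ij}(X)=\begin{cases}I_{ij}&\text{if } i\notin\rho(t),\\ X_{ij}&\text{else if } t=0\text{ or }i\notin\rho(t-1),\\ \delta^{t-1}_{ij}(X)&\text{else if } i\notin\alpha(t),\\ F_{A^{\eta(t)\rho(t)}}(L)_{ij}&\text{otherwise, where } L_{kl}=\delta^{\beta(t,i,k)}_{kl}(X).\end{cases}$$ **Pseudocycles.** A period $[t_1,t_2]$ with $\eta(t_1)=\eta(t_2)$ is an expiry period for $i$ if $t_1\le\beta(t,i,j)$ for all $j\in V$ and $t\ge t_2$; it is an activation period for $i$ if $i\in\alpha(t)$ for some $t\in[t_1,t_2]$; it is a pseudocycle if for every $i\in\rho(t_1)$ there is $t\in[t_1,t_2]$ such that $[t_1,t]$ is an expiry period for $i$ and $[t,t_2]$ is an activation period for $i$. We say that $[t_1,t_2]$ contains $k$ pseudocycles if $\eta(t_1)=\eta(t_2)$ and there are pseudocycles $[s_l,e_l]\subseteq[t_1,t_2]$, $0\le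 l<k$, with $e_l\le s_{l+1}$ and $s_l<s_{l+1}$. **Theorem.** Let $(S,\oplus,E,\overline 0,\overline\infty,f^\infty,path)$ be increasing, a routing algebra and a path algebra. Then for every finite $V\subseteq\mathbb V$ and every network $N$ the protocol $\delta$ is always convergent, i.e. convergent over the set of all configurations $(e,p)\in\mathbb N\times 2^V$: for every $(e,p)$ there are a fixed point $X^*_{ep}$ of $F_{A^{ep}}$ and a number $k^*_{ep}\in\mathbb N$ such that, for every initial state $X$, every schedule and all times $t_1\le t_2$, if $[t_1,t_2]$ contains $k^*_{\eta(t_1)\rho(t_1)}$ pseudocycles, then $\delta^{t_3}(X)=X^*_{\eta(t_1)\rho(t_1)}$ for every $t_3\ge t_2$ with $\eta(t_3)=\eta(t_2)$. -/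

import Mathlib

/-- The routers visited by a sequence of edges, in order; the empty sequence visits none. -/
def pathVertices {𝕍 : Type*} : List (𝕍 × 𝕍) → List 𝕍
  | [] => []
  | e :: p => e.1 :: (e :: p).map Prod.snd

/-- A simple path other than `⊥`: a sequence of contiguous edges (arbitrary pairs of router
identifiers) that visits no router twice. The empty sequence is the trivial path `[]`. -/
structure SimplePath (𝕍 : Type*) where
  edges : List (𝕍 × 𝕍)
  contiguous : edges.IsChain (fun e e' => e.2 = e'.1)
  simple : (pathVertices edges).Nodup

namespace SimplePath

/-- The trivial path. -/
def trivial (𝕍 : Type*) : SimplePath 𝕍 where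
  edges := []
  contiguous := List.isChain_nil
  simple := List.nodup_nil

end SimplePath

/-- The set `ℙ` of simple paths, including the invalid path `⊥`, which is `none`. -/
abbrev RoutePath (𝕍 : Type*) := Option (SimplePath 𝕍)

namespace RoutePath

/-- The router `i` occurs on the path `p`. No router occurs on `⊥` or on the trivial path. -/
def Visits {𝕍 : Type*} (i : 𝕍) (p : RoutePath 𝕍) : Prop :=
  ∃ q, p = some q ∧ i ∈ pathVertices q.edges

/-- The edge `e` is aligned with `p`: either `p` is the trivial path or the destination of `e` is
the origin of `p`. No edge is aligned with `⊥`. -/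
def Aligned {𝕍 : Type*} (e : 𝕍 × 𝕍) (p : RoutePath 𝕍) : Prop :=
  ∃ q, p = some q ∧ (q.edges = [] ∨ ∃ e' q', q.edges = e' :: q' ∧ e.2 = e'.1)

/-- `r` is the path `e :: p`. -/
def IsCons {𝕍 : Type*} (e : 𝕍 × 𝕍) (p r : RoutePath 𝕍) : Prop :=
  ∃ q q', p = some q ∧ r = some q' ∧ q'.edges = e :: q.edges

end RoutePath

/-- A raw routing algebra `(S, ⊕, E, 0, ∞, f^∞)` over the set `𝕍` of router identifiers. -/
structure RawRoutingAlgebra (𝕍 : Type*) (S : Type*) where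
  /-- the choice operator `⊕` -/
  choice : S → S → S
  /-- the set `E i j` of policy functions that may be used on the edge `(i, j)` -/
  E : 𝕍 → 𝕍 → Set (S → S)
  /-- the path-weight of the trivial path -/
  zero : S
  /-- the invalid path-weight -/
  inf : S
  /-- the designated policy `f^∞ i j ∈ E i j` that stands for an absent link -/
  finf : ∀ i j, E i j

namespace RawRoutingAlgebra

variable {𝕍 : Type*} {S : Type*}

/-- The axioms of a routing algebra. -/
structure IsRoutingAlgebra (R : RawRoutingAlgebra 𝕍 S) : Prop where
  selective : ∀ x y, R.choice x y = x ∨ R.choice x y = y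
  assoc : ∀ x y z, R.choice x (R.choice y z) = R.choice (R.choice x y) z
  comm : ∀ x y, R.choice x y = R.choice y x
  zero_annihilator : ∀ x, R.choice x R.zero = R.zero ∧ R.choice R.zero x = R.zero
  inf_identity : ∀ x, R.choice x R.inf = x ∧ R.choice R.inf x = x
  inf_fixed : ∀ i j, ∀ f ∈ R.E i j, f R.inf = R.inf
  finf_const : ∀ i j x, (R.finf i j : S → S) x = R.inf

/-- The axioms that make `R`, equipped with `path : S → ℙ`, a path algebra.
In `path_extend` a policy may also reject the extended path: the constantly invalid policies
`f^∞ i j` belong to `E i j`, and they (like every filtering policy) send path-weights with an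
extendable path to `∞`. If `(i, j) :: path x` is not simple because `i = j`, then `path_extend`
leaves `⊥` as the only possibility, as elements of `RoutePath 𝕍` are simple. -/
structure IsPathAlgebra (R : RawRoutingAlgebra 𝕍 S) (path : S → RoutePath 𝕍) : Prop where
  path_inf : ∀ x, x = R.inf ↔ path x = none
  path_zero : ∀ x, x = R.zero → path x = some (SimplePath.trivial 𝕍)
  path_loop : ∀ i j, ∀ f ∈ R.E i j, ∀ x, (path x).Visits i → path (f x) = none
  path_misaligned : ∀ i j, ∀ f ∈ R.E i j, ∀ x, ¬ (path x).Aligned (i, j) → path (f x) = none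
  path_extend : ∀ i j, ∀ f ∈ R.E i j, ∀ x, ¬ (path x).Visits i → (path x).Aligned (i, j) →
    path (f x) = none ∨ (path x).IsCons (i, j) (path (f x))

/-- The preference relation `x ≤ y` over path-weights. -/
def Pref (R : RawRoutingAlgebra 𝕍 S) (x y : S) : Prop := R.choice x y = x

/-- The algebra is increasing. -/
def IsIncreasing (R : RawRoutingAlgebra 𝕍 S) : Prop :=
  ∀ i j, ∀ f ∈ R.E i j, ∀ x, R.Pref x (f x)

/-- An adjacency matrix over the finite set `V` of routers: a choice of a policy for each edge. -/
abbrev Topology (R : RawRoutingAlgebra 𝕍 S) (V : Finset 𝕍) := ∀ i j : V, R.E i j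

/-- A dynamic network: the topology during each epoch. Epochs are natural numbers. -/
abbrev Network (R : RawRoutingAlgebra 𝕍 S) (V : Finset 𝕍) := ℕ → R.Topology V

/-- A global routing state: a `V × V` matrix over `S`. -/
abbrev State (_R : RawRoutingAlgebra 𝕍 S) (V : Finset 𝕍) := V → V → S

open Classical in
/-- The identity matrix `I`. -/
noncomputable def idMatrix (R : RawRoutingAlgebra 𝕍 S) (V : Finset 𝕍) : R.State V :=
  fun i j => if i = j then R.zero else R.inf

/-- The application `A(X) i j = ⨁ k, A i k (X k j)`. The empty sum is `∞`. The sum is taken in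
some enumeration of `V`, which does not matter when `⊕` is associative and commutative. -/
noncomputable def apply (R : RawRoutingAlgebra 𝕍 S) {V : Finset 𝕍} (A : R.Topology V)
    (X : R.State V) : R.State V :=
  fun i j => ((Finset.univ : Finset V).toList.map
    (fun k => (A i k : S → S) (X k j))).foldr R.choice R.inf

/-- One synchronous round, `F_A(X) = A(X) ⊕ I`. -/
noncomputable def iter (R : RawRoutingAlgebra 𝕍 S) {V : Finset 𝕍} (A : R.Topology V)
    (X : R.State V) : R.State V :=
  fun i j => R.choice (R.apply A X i j) (R.idMatrix V i j)

open Classical in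
/-- The participating topology `A^{ep}`. -/
noncomputable def partTopology (R : RawRoutingAlgebra 𝕍 S) {V : Finset 𝕍} (N : R.Network V)
    (e : ℕ) (p : Set V) : R.Topology V :=
  fun i j => if i ∈ p ∧ j ∈ p then N e i j else R.finf i j

end RawRoutingAlgebra

/-- A schedule for the routers `V`. Times and epochs are natural numbers. -/
structure Schedule (V : Type*) where
  /-- activation function -/
  α : ℕ → Set V
  /-- data flow function -/
  β : ℕ → V → V → ℕ
  /-- epoch function -/
  η : ℕ → ℕ
  /-- participants function -/
  π : ℕ → Set V
  causal : ∀ i j t, β (t + 1) i j ≤ t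
  epoch_mono : ∀ t₁ t₂, t₁ ≤ t₂ → η t₁ ≤ η t₂

namespace Schedule

variable {V : Type*}

/-- The set of participants at time `t`. -/
def ρ (ψ : Schedule V) (t : ℕ) : Set V := ψ.π (ψ.η t)

/-- `[t₁, t₂]` is an expiry period for `i`. -/
def IsExpiryPeriod (ψ : Schedule V) (i : V) (t₁ t₂ : ℕ) : Prop :=
  t₁ ≤ t₂ ∧ ψ.η t₁ = ψ.η t₂ ∧ ∀ j t, t₂ ≤ t → t₁ ≤ ψ.β t i j

/-- `[t₁, t₂]` is a dynamic activation period for `i`. -/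
def IsActivationPeriod (ψ : Schedule V) (i : V) (t₁ t₂ : ℕ) : Prop :=
  t₁ ≤ t₂ ∧ ψ.η t₁ = ψ.η t₂ ∧ ∃ t, t₁ ≤ t ∧ t ≤ t₂ ∧ i ∈ ψ.α t

/-- `[t₁, t₂]` is a dynamic pseudocycle. -/
def IsPseudocycle (ψ : Schedule V) (t₁ t₂ : ℕ) : Prop :=
  t₁ ≤ t₂ ∧ ψ.η t₁ = ψ.η t₂ ∧ ∀ i ∈ ψ.ρ t₁, ∃ t, t₁ ≤ t ∧ t ≤ t₂ ∧
    ψ.IsExpiryPeriod i t₁ t ∧ ψ.IsActivationPeriod i t t₂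

/-- The period `[t₁, t₂]` lies in one epoch and contains `k` successive pseudocycles
`[s 0, e 0], …, [s (k-1), e (k-1)]`. Successive ones may share an endpoint but not their starting
time. The latter is a restriction only after a one-point pseudocycle `[t, t]`, which exists only
if `t = 0` or nobody participates at time `t`, and which must not be counted repeatedly. -/
def ContainsPseudocycles (ψ : Schedule V) (t₁ t₂ k : ℕ) : Prop :=
  t₁ ≤ t₂ ∧ ψ.η t₁ = ψ.η t₂ ∧ ∃ s e : ℕ → ℕ,
    (∀ l < k, t₁ ≤ s l ∧ e l ≤ t₂ ∧ ψ.IsPseudocycle (s l) (e l)) ∧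
    ∀ l, l + 1 < k → e l ≤ s (l + 1) ∧ s l < s (l + 1)

end Schedule

namespace RawRoutingAlgebra

variable {𝕍 : Type*} {S : Type*}

open Classical in
/-- The asynchronous state function: `R.asyncState N ψ X t` is `δ^t(X)`. -/
noncomputable def asyncState (R : RawRoutingAlgebra 𝕍 S) {V : Finset 𝕍} (N : R.Network V)
    (ψ : Schedule V) (X : R.State V) : ℕ → R.State V
  | 0 => fun i j => if i ∉ ψ.ρ 0 then R.idMatrix V i j else X i j
  | t + 1 => fun i j =>
      if i ∉ ψ.ρ (t + 1) then R.idMatrix V i j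
      else if i ∉ ψ.ρ t then X i j
      else if i ∉ ψ.α (t + 1) then R.asyncState N ψ X t i j
      else R.iter (R.partTopology N (ψ.η (t + 1)) (ψ.ρ (t + 1)))
        (fun k l => R.asyncState N ψ X (ψ.β (t + 1) i k) k l) i j
termination_by t => t
decreasing_by
  · exact Nat.lt_succ_self t
  · exact Nat.lt_succ_of_le (ψ.causal i k t)

/-- The protocol `δ` on the network `N` is convergent over the set `C` of configurations. -/
def ConvergentOver (R : RawRoutingAlgebra 𝕍 S) {V : Finset 𝕍} (N : R.Network V)
    (C : Set (ℕ × Set V)) : Prop :=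
  ∃ (Xs : ℕ → Set V → R.State V) (ks : ℕ → Set V → ℕ),
    (∀ e p, (e, p) ∈ C → R.iter (R.partTopology N e p) (Xs e p) = Xs e p) ∧
    ∀ (X : R.State V) (ψ : Schedule V) (t₁ t₂ : ℕ), (ψ.η t₁, ψ.ρ t₁) ∈ C →
      ψ.ContainsPseudocycles t₁ t₂ (ks (ψ.η t₁) (ψ.ρ t₁)) →
      ∀ t₃, t₂ ≤ t₃ → ψ.η t₂ = ψ.η t₃ →
        R.asyncState N ψ X t₃ = Xs (ψ.η t₁) (ψ.ρ t₁)

/-- Convergent over all configurations. -/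
def AlwaysConvergent (R : RawRoutingAlgebra 𝕍 S) {V : Finset 𝕍} (N : R.Network V) : Prop :=
  R.ConvergentOver N Set.univ

end RawRoutingAlgebra

/-! Fix a configuration, with topology `A`. A sequence of boxes is found such that `F_A` maps each
into the next; a pseudocycle does the same for the asynchronous state, since every participant
recomputes its row from data no older than the start (`asyncState_mem_of_isPseudocycle`). The boxes
shrink to one fixed point for two reasons.

Flushing: the initial state may hold weights unrelated to `A`. Each round puts an edge in front of
their paths; simple paths have distinct edge sources, so none survives `|V| + 1` rounds. What
remains lies in a finite set `C` of weights generated by `A`.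

Contraction: in `C`, rank a weight by the number of better ones. If two states agree except at
entries of rank at least `n`, their images agree except at rank at least `n + 1`
(`iter_agreeBelow`), because extending a valid weight makes it strictly worse. Ranks are at most
`|C|`, which also yields the fixed point by iteration from `I`. -/

theorem map_fst_sublist_pathVertices {𝕍 : Type*} : ∀ l : List (𝕍 × 𝕍),
    l.IsChain (fun e e' => e.2 = e'.1) → List.Sublist (l.map Prod.fst) (pathVertices l)
  | [], _ => by simp
  | [e], _ => by simp [pathVertices]
  | e :: e' :: l, h => by
    rw [List.isChain_cons_cons] at h
    have ih := map_fst_sublist_pathVertices (e' :: l) h.2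
    have : pathVertices (e :: e' :: l) = e.1 :: pathVertices (e' :: l) := by
      simp [pathVertices, h.1]
    rw [this, List.map_cons]
    exact ih.cons_cons _

namespace RoutePath

/-- The path has at least `n` edges, and the first `n` of them start in `V`. -/
def StartsIn {𝕍 : Type*} (V : Finset 𝕍) (n : ℕ) (p : RoutePath 𝕍) : Prop :=
  ∃ q, p = some q ∧ n ≤ q.edges.length ∧ ∀ e ∈ q.edges.take n, e.1 ∈ V

/-- The sources of the edges of a simple path are distinct. Only the first `n` need lie in `V`, as
an arbitrary initial path may leave `V` afterwards. -/
theorem StartsIn.le_card {𝕍 : Type*} {V : Finset 𝕍} {n : ℕ} {p : RoutePath 𝕍}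
    (h : p.StartsIn V n) : n ≤ V.card := by
  classical
  obtain ⟨q, -, hn, hV⟩ := h
  have hnd : ((q.edges.take n).map Prod.fst).Nodup :=
    (q.simple.sublist (map_fst_sublist_pathVertices _ q.contiguous)).sublist
      ((List.take_sublist n q.edges).map _)
  have hsub : ((q.edges.take n).map Prod.fst).toFinset ⊆ V := by
    intro v hv
    rw [List.mem_toFinset, List.mem_map] at hv
    obtain ⟨e, he, rfl⟩ := hv
    exact hV e he
  have hcard := Finset.card_le_card hsub
  rwa [List.toFinset_card_of_nodup hnd, List.length_map, List.length_take,
    min_eq_left hn] at hcard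

end RoutePath

namespace RawRoutingAlgebra

variable {𝕍 : Type*} {S : Type*} {R : RawRoutingAlgebra 𝕍 S}

/-! ### The preference order and the entries of `F_A` -/

namespace IsRoutingAlgebra

theorem pref_refl (hR : R.IsRoutingAlgebra) (x : S) : R.Pref x x := by
  rcases hR.selective x x with h | h <;> exact h

theorem pref_antisymm (hR : R.IsRoutingAlgebra) {x y : S} (h : R.Pref x y) (h' : R.Pref y x) :
    x = y := by
  unfold Pref at h h'
  rw [← h, hR.comm, h']

theorem pref_trans (hR : R.IsRoutingAlgebra) {x y z : S} (h : R.Pref x y) (h' : R.Pref y z) :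
    R.Pref x z := by
  unfold Pref at h h' ⊢
  rw [← h, ← hR.assoc, h']

theorem pref_total (hR : R.IsRoutingAlgebra) (x y : S) : R.Pref x y ∨ R.Pref y x := by
  rcases hR.selective x y with h | h
  · exact Or.inl h
  · exact Or.inr (by unfold Pref; rw [hR.comm, h])

theorem pref_inf (hR : R.IsRoutingAlgebra) (x : S) : R.Pref x R.inf := (hR.inf_identity x).1

theorem choice_pref_left (hR : R.IsRoutingAlgebra) (x y : S) : R.Pref (R.choice x y) x := by
  unfold Pref
  rw [hR.comm, hR.assoc, hR.pref_refl x]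

theorem choice_pref_right (hR : R.IsRoutingAlgebra) (x y : S) : R.Pref (R.choice x y) y := by
  rw [hR.comm]
  exact hR.choice_pref_left y x

theorem foldr_choice_pref (hR : R.IsRoutingAlgebra) {l : List S} {x : S} (hx : x ∈ l) :
    R.Pref (l.foldr R.choice R.inf) x := by
  induction l with
  | nil => simp at hx
  | cons a l ih =>
    rw [List.foldr_cons]
    rcases List.mem_cons.1 hx with rfl | h
    · exact hR.choice_pref_left _ _
    · exact hR.pref_trans (hR.choice_pref_right _ _) (ih h)

theorem foldr_choice_mem (hR : R.IsRoutingAlgebra) (l : List S) :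
    l.foldr R.choice R.inf = R.inf ∨ l.foldr R.choice R.inf ∈ l := by
  induction l with
  | nil => simp
  | cons a l ih =>
    rw [List.foldr_cons]
    rcases hR.selective a (l.foldr R.choice R.inf) with h | h
    · right; rw [h]; simp
    · rw [h]
      exact ih.imp_right (List.mem_cons_of_mem _)

variable {V : Finset 𝕍}

theorem iter_pref_apply (hR : R.IsRoutingAlgebra) (A : R.Topology V) (X : R.State V) (i j k : V) :
    R.Pref (R.iter A X i j) ((A i k : S → S) (X k j)) :=
  hR.pref_trans (hR.choice_pref_left _ _) (hR.foldr_choice_pref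
    (List.mem_map.2 ⟨k, by simp, rfl⟩))

theorem iter_pref_idMatrix (hR : R.IsRoutingAlgebra) (A : R.Topology V) (X : R.State V)
    (i j : V) : R.Pref (R.iter A X i j) (R.idMatrix V i j) :=
  hR.choice_pref_right _ _

theorem iter_cases (hR : R.IsRoutingAlgebra) (A : R.Topology V) (X : R.State V) (i j : V) :
    R.iter A X i j = R.inf ∨ R.iter A X i j = R.idMatrix V i j ∨
      ∃ k, R.iter A X i j = (A i k : S → S) (X k j) := by
  rcases hR.selective (R.apply A X i j) (R.idMatrix V i j) with h | h
  · rcases hR.foldr_choice_mem ((Finset.univ : Finset V).toList.map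
      (fun k => (A i k : S → S) (X k j))) with h' | h'
    · exact Or.inl (h.trans h')
    · obtain ⟨k, -, hk⟩ := List.mem_map.1 h'
      exact Or.inr (Or.inr ⟨k, h.trans hk.symm⟩)
  · exact Or.inr (Or.inl h)

/-- A router that does not participate holds its row of the identity matrix. -/
theorem iter_partTopology_of_notMem (hR : R.IsRoutingAlgebra) (N : R.Network V) (e : ℕ)
    (p : Set V) (X : R.State V) {i : V} (hi : i ∉ p) (j : V) :
    R.iter (R.partTopology N e p) X i j = R.idMatrix V i j := by
  rcases hR.iter_cases (R.partTopology N e p) X i j with h | h | ⟨k, h⟩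
  · exact hR.pref_antisymm (hR.iter_pref_idMatrix _ _ _ _) (h ▸ hR.pref_inf _)
  · exact h
  · have h' : R.iter (R.partTopology N e p) X i j = R.inf := by
      rw [h, partTopology, if_neg (fun hc => hi hc.1), hR.finf_const]
    exact hR.pref_antisymm (hR.iter_pref_idMatrix _ _ _ _) (h' ▸ hR.pref_inf _)

end IsRoutingAlgebra

/-! ### From synchronous boxes to asynchronous states -/

section Asynchronous

variable {V : Finset 𝕍} {N : R.Network V} {ψ : Schedule V}

/-- Over a pseudocycle that does not start at time `0`, the asynchronous state moves from one box
to any box that contains the image of the first. -/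
theorem asyncState_mem_of_isPseudocycle (hR : R.IsRoutingAlgebra) (X : R.State V) {s e : ℕ}
    (hs : 0 < s) (hpc : ψ.IsPseudocycle s e) {B B' : V → V → Set S}
    (hF : ∀ Y : R.State V, (∀ i j, Y i j ∈ B i j) →
      ∀ i j, R.iter (R.partTopology N (ψ.η s) (ψ.ρ s)) Y i j ∈ B' i j)
    (hB : ∀ t, s ≤ t → ψ.η s = ψ.η t → ∀ i j, R.asyncState N ψ X t i j ∈ B i j) :
    ∀ t, e ≤ t → ψ.η s = ψ.η t → ∀ i j, R.asyncState N ψ X t i j ∈ B' i j := by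
  intro t het hst i j
  obtain ⟨hse, -, hpc⟩ := hpc
  have hρ : ∀ t, ψ.η s = ψ.η t → ψ.ρ t = ψ.ρ s := fun t h => by
    unfold Schedule.ρ; rw [h]
  have hη : ∀ a b, s ≤ a → a ≤ b → ψ.η s = ψ.η b → ψ.η s = ψ.η a := fun a b h₁ h₂ h =>
    le_antisymm (ψ.epoch_mono _ _ h₁) (h ▸ ψ.epoch_mono _ _ h₂)
  by_cases hi : i ∈ ψ.ρ s
  · obtain ⟨u, hsu, hue, ⟨-, -, hexp⟩, -, -, a, hua, hae, ha⟩ := hpc i hi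
    -- Expiry forces data used at `a` to date from `s` or later, causality from before `a`. Hence
    -- `i` already participates at time `a - 1`, and the activation at `a` is a genuine
    -- recomputation.
    have hsa : s < a := by
      rcases (hsu.trans hua).lt_or_eq with h | h
      · exact h
      · have h₁ := hexp i a hua
        obtain ⟨b, rfl⟩ : ∃ b, a = b + 1 := ⟨a - 1, by omega⟩
        have h₂ := ψ.causal i i b
        omega
    have step : ∀ b, u ≤ b + 1 → ψ.η s = ψ.η (b + 1) →
        R.iter (R.partTopology N (ψ.η (b + 1)) (ψ.ρ (b + 1)))
          (fun k l => R.asyncState N ψ X (ψ.β (b + 1) i k) k l) i j ∈ B' i j := by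
      intro b hub hb
      rw [hρ _ hb, ← hb]
      refine hF _ (fun k l => hB _ (hexp k _ hub) ?_ k l) i j
      exact hη _ _ (hexp k _ hub) ((ψ.causal i k b).trans (Nat.le_succ b)) hb
    have key : ∀ t, a ≤ t → ψ.η s = ψ.η t → R.asyncState N ψ X t i j ∈ B' i j := by
      intro t hat
      induction t with
      | zero => omega
      | succ t ih =>
        intro ht
        have ht' : ψ.η s = ψ.η t := hη t (t + 1) (by omega) (Nat.le_succ t) ht
        rw [asyncState]
        beta_reduce
        rw [if_neg (by rw [hρ _ ht]; exact not_not.2 hi),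
          if_neg (by rw [hρ _ ht']; exact not_not.2 hi)]
        split_ifs with hα
        · exact step t (by omega) ht
        · rcases hat.lt_or_eq with h | h
          · exact ih (by omega) ht'
          · exact absurd (h ▸ ha) hα
    exact key t (hae.trans het) hst
  · have hI : R.asyncState N ψ X t i j = R.idMatrix V i j := by
      cases t with
      | zero =>
        rw [asyncState]
        exact if_pos (by rwa [hρ _ hst])
      | succ t =>
        rw [asyncState]
        exact if_pos (by rwa [hρ _ hst])
    -- The identity entry is also an entry of `F_A` at the state of time `s`, so the box hypothesis
    -- applies to it.
    rw [hI, ← hR.iter_partTopology_of_notMem N (ψ.η s) (ψ.ρ s) (R.asyncState N ψ X s) hi j]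
    exact hF _ (hB s le_rfl rfl) i j

/-- After `n + 1` pseudocycles the asynchronous state lies in the `n`-th of a sequence of boxes,
each of which contains the image of its predecessor. One pseudocycle may be lost
at time `0`. -/
theorem asyncState_mem_of_containsPseudocycles (hR : R.IsRoutingAlgebra) (X : R.State V)
    {t₁ t₂ n : ℕ} (B : ℕ → V → V → Set S) (hB : ∀ i j, B 0 i j = Set.univ)
    (hF : ∀ n, ∀ Y : R.State V, (∀ i j, Y i j ∈ B n i j) →
      ∀ i j, R.iter (R.partTopology N (ψ.η t₁) (ψ.ρ t₁)) Y i j ∈ B (n + 1) i j)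
    (hc : ψ.ContainsPseudocycles t₁ t₂ (n + 1)) :
    ∀ t, t₂ ≤ t → ψ.η t₂ = ψ.η t → ∀ i j, R.asyncState N ψ X t i j ∈ B n i j := by
  obtain ⟨-, h₁₂, s, e, hse, hsucc⟩ := hc
  have hηs : ∀ l < n + 1, ψ.η (s l) = ψ.η t₁ := fun l hl => by
    obtain ⟨h₁, h₂, h₃, -, -⟩ := hse l hl
    exact le_antisymm (h₁₂ ▸ ψ.epoch_mono _ _ (h₃.trans h₂)) (ψ.epoch_mono _ _ h₁)
  have main : ∀ l < n + 1, ∀ t, e l ≤ t → ψ.η t₁ = ψ.η t →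
      ∀ i j, R.asyncState N ψ X t i j ∈ B l i j := by
    intro l
    induction l with
    | zero => intro _ t _ _ i j; rw [hB]; trivial
    | succ l ih =>
      intro hl t ht hηt
      -- Strictly increasing starting times make `s (l + 1)` positive; only the pseudocycle with
      -- index `0` can be wasted.
      obtain ⟨hel, hsl⟩ := hsucc l hl
      have hη := hηs (l + 1) hl
      refine asyncState_mem_of_isPseudocycle hR X (B := B l) (by omega) (hse (l + 1) hl).2.2
        ?_ ?_ t ht (hη.trans hηt)
      · have hρ : ψ.ρ (s (l + 1)) = ψ.ρ t₁ := by unfold Schedule.ρ; rw [hη]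
        rw [hη, hρ]
        exact hF l
      · exact fun t ht hηt => ih (by omega) t (hel.trans ht) (hη.symm.trans hηt)
  intro t ht hηt
  exact main n (Nat.lt_succ_self n) t ((hse n (Nat.lt_succ_self n)).2.1.trans ht) (h₁₂.trans hηt)

end Asynchronous

/-! ### Flushing out inconsistent path-weights -/

section Consistent

variable {V : Finset 𝕍} {path : S → RoutePath 𝕍}

theorem IsPathAlgebra.isCons_of_ne_inf (hP : R.IsPathAlgebra path) {i j : 𝕍} {f : S → S}
    (hf : f ∈ R.E i j) {x : S} (h : f x ≠ R.inf) : (path x).IsCons (i, j) (path (f x)) := by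
  have hne : path (f x) ≠ none := fun hn => h ((hP.path_inf _).2 hn)
  have hv : ¬ (path x).Visits i := fun hv => hne (hP.path_loop i j f hf x hv)
  have ha : (path x).Aligned (i, j) := by
    by_contra ha
    exact hne (hP.path_misaligned i j f hf x ha)
  exact (hP.path_extend i j f hf x hv ha).resolve_left hne

theorem IsPathAlgebra.startsIn_succ (hP : R.IsPathAlgebra path) {i j : 𝕍} {f : S → S}
    (hf : f ∈ R.E i j) (hi : i ∈ V) {n : ℕ} {x : S} (hx : (path x).StartsIn V n)
    (h : f x ≠ R.inf) : (path (f x)).StartsIn V (n + 1) := by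
  obtain ⟨q, q', hq, hq', hcons⟩ := hP.isCons_of_ne_inf hf h
  obtain ⟨r, hr, hn, hV⟩ := hx
  obtain rfl : q = r := Option.some.inj (hq.symm.trans hr)
  refine ⟨q', hq', by rw [hcons]; simpa using hn, fun e he => ?_⟩
  rw [hcons, List.take_succ_cons] at he
  rcases List.mem_cons.1 he with rfl | he
  · exact hi
  · exact hV e he

/-- Extending a valid path-weight changes it, as its path changes. -/
theorem IsPathAlgebra.apply_ne_self (hP : R.IsPathAlgebra path) {i j : 𝕍} {f : S → S}
    (hf : f ∈ R.E i j) {x : S} (hx : x ≠ R.inf) : f x ≠ x := by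
  intro h
  obtain ⟨q, q', hq, hq', hcons⟩ := hP.isCons_of_ne_inf hf (h ▸ hx)
  rw [h, hq] at hq'
  obtain rfl : q = q' := Option.some.inj hq'
  simpa using congrArg List.length hcons

/-- The path-weights obtained from `0` and `∞` by `n` extensions in the topology `A`. -/
def weightsOfLength (A : R.Topology V) : ℕ → Set S
  | 0 => {R.zero, R.inf}
  | n + 1 => ⋃ (i : V) (k : V), (A i k : S → S) '' weightsOfLength A n

/-- The path-weights of the paths in the topology `A`. -/
def consistentWeights (A : R.Topology V) : Set S :=
  ⋃ n ∈ Set.Iic V.card, weightsOfLength A n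

theorem weightsOfLength_finite (A : R.Topology V) (n : ℕ) : (weightsOfLength A n).Finite := by
  induction n with
  | zero => simp [weightsOfLength]
  | succ n ih => exact Set.finite_iUnion fun i => Set.finite_iUnion fun k => ih.image _

theorem consistentWeights_finite (A : R.Topology V) : (consistentWeights A).Finite :=
  (Set.finite_Iic _).biUnion fun n _ => weightsOfLength_finite A n

theorem inf_mem_consistentWeights (A : R.Topology V) : R.inf ∈ consistentWeights A :=
  Set.mem_biUnion (Nat.zero_le _) (by simp [weightsOfLength])

theorem zero_mem_consistentWeights (A : R.Topology V) : R.zero ∈ consistentWeights A :=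
  Set.mem_biUnion (Nat.zero_le _) (by simp [weightsOfLength])

theorem idMatrix_mem_consistentWeights (A : R.Topology V) (i j : V) :
    R.idMatrix V i j ∈ consistentWeights A := by
  unfold idMatrix
  split_ifs
  · exact zero_mem_consistentWeights A
  · exact inf_mem_consistentWeights A

theorem IsPathAlgebra.startsIn_of_mem_weightsOfLength (hR : R.IsRoutingAlgebra)
    (hP : R.IsPathAlgebra path) (A : R.Topology V) {n : ℕ} {x : S}
    (hx : x ∈ weightsOfLength A n) (h : x ≠ R.inf) : (path x).StartsIn V n := by
  induction n generalizing x with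
  | zero =>
    obtain rfl : x = R.zero := by
      rcases hx with hx | hx
      · exact hx
      · exact absurd hx h
    exact ⟨_, hP.path_zero _ rfl, by simp, by simp⟩
  | succ n ih =>
    simp only [weightsOfLength, Set.mem_iUnion] at hx
    obtain ⟨i, k, y, hy, rfl⟩ := hx
    refine hP.startsIn_succ (A i k).2 i.2 (ih hy ?_) h
    rintro rfl
    exact h (hR.inf_fixed _ _ _ (A i k).2)

/-- The length bound `|V|` costs nothing: a valid weight obtained by `n + 1` extensions has a path
with that many distinct sources in `V`, and an invalid one is `∞`. -/
theorem IsPathAlgebra.apply_mem_consistentWeights (hR : R.IsRoutingAlgebra)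
    (hP : R.IsPathAlgebra path) (A : R.Topology V) {x : S} (hx : x ∈ consistentWeights A)
    (i k : V) : (A i k : S → S) x ∈ consistentWeights A := by
  obtain ⟨n, hn, hx⟩ := Set.mem_iUnion₂.1 hx
  have hx' : (A i k : S → S) x ∈ weightsOfLength A (n + 1) := by
    simp only [weightsOfLength, Set.mem_iUnion]
    exact ⟨i, k, x, hx, rfl⟩
  by_cases h : (A i k : S → S) x = R.inf
  · rw [h]
    exact inf_mem_consistentWeights A
  · exact Set.mem_biUnion (hP.startsIn_of_mem_weightsOfLength hR A hx' h).le_card hx'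

/-- The path-weights that are consistent with `A`, or whose path starts with `n` edges out of
routers in `V`. -/
def nearlyConsistent (path : S → RoutePath 𝕍) (A : R.Topology V) (n : ℕ) : Set S :=
  {x | x ∈ consistentWeights A ∨ (path x).StartsIn V n}

theorem IsPathAlgebra.nearlyConsistent_zero (hP : R.IsPathAlgebra path) (A : R.Topology V) :
    nearlyConsistent path A 0 = Set.univ := by
  refine Set.eq_univ_of_forall fun x => ?_
  by_cases h : x = R.inf
  · exact Or.inl (h ▸ inf_mem_consistentWeights A)
  · obtain ⟨q, hq⟩ := Option.ne_none_iff_exists'.1 fun hn => h ((hP.path_inf x).2 hn)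
    exact Or.inr ⟨q, hq, by simp, by simp⟩

theorem nearlyConsistent_of_card_lt {A : R.Topology V} {n : ℕ} (hn : V.card < n) :
    nearlyConsistent path A n = consistentWeights A := by
  refine Set.ext fun x => ⟨fun h => h.resolve_right fun h' => ?_, Or.inl⟩
  exact absurd h'.le_card (not_le.2 hn)

theorem IsPathAlgebra.iter_mem_nearlyConsistent (hR : R.IsRoutingAlgebra)
    (hP : R.IsPathAlgebra path) (A : R.Topology V) {n : ℕ} {X : R.State V}
    (hX : ∀ i j, X i j ∈ nearlyConsistent path A n) (i j : V) :
    R.iter A X i j ∈ nearlyConsistent path A (n + 1) := by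
  rcases hR.iter_cases A X i j with h | h | ⟨k, h⟩
  · exact Or.inl (h ▸ inf_mem_consistentWeights A)
  · exact Or.inl (h ▸ idMatrix_mem_consistentWeights A i j)
  · rw [h]
    by_cases hinf : (A i k : S → S) (X k j) = R.inf
    · exact Or.inl (hinf ▸ inf_mem_consistentWeights A)
    · exact (hX k j).imp (fun hx => hP.apply_mem_consistentWeights hR A hx i k)
        fun hx => hP.startsIn_succ (A i k).2 i.2 hx hinf

theorem IsPathAlgebra.iter_mem_consistentWeights (hR : R.IsRoutingAlgebra)
    (hP : R.IsPathAlgebra path) (A : R.Topology V) {X : R.State V}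
    (hX : ∀ i j, X i j ∈ consistentWeights A) (i j : V) :
    R.iter A X i j ∈ consistentWeights A := by
  -- Beyond `|V|` near consistency is consistency, so the preceding lemma applies at `n = |V| + 1`.
  rw [← nearlyConsistent_of_card_lt (path := path) (Nat.lt_succ_self V.card)] at hX
  rw [← nearlyConsistent_of_card_lt (path := path) (Nat.lt_succ_of_lt (Nat.lt_succ_self V.card))]
  exact hP.iter_mem_nearlyConsistent hR A hX i j

end Consistent

/-! ### Contraction by rank -/

section Contraction

variable {V : Finset 𝕍} {path : S → RoutePath 𝕍}

/-- The number of consistent path-weights that are strictly preferred to `x`. -/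
noncomputable def rank (A : R.Topology V) (x : S) : ℕ :=
  {y ∈ consistentWeights A | R.Pref y x ∧ y ≠ x}.ncard

theorem rank_le (A : R.Topology V) (x : S) : rank A x ≤ (consistentWeights A).ncard :=
  Set.ncard_le_ncard (Set.sep_subset _ _) (consistentWeights_finite A)

/-- The weight `x` is itself counted for `y` but not for `x`; this needs `x` consistent. -/
theorem IsRoutingAlgebra.rank_lt (hR : R.IsRoutingAlgebra) (A : R.Topology V) {x y : S}
    (hx : x ∈ consistentWeights A) (h : R.Pref x y) (hne : x ≠ y) : rank A x < rank A y := by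
  refine Set.ncard_lt_ncard ⟨?_, fun hsub => ?_⟩
    ((consistentWeights_finite A).subset (Set.sep_subset _ _))
  · rintro z ⟨hz, hzx, hzne⟩
    refine ⟨hz, hR.pref_trans hzx h, ?_⟩
    rintro rfl
    exact hzne (hR.pref_antisymm hzx h)
  · exact (hsub (show x ∈ _ from ⟨hx, h, hne⟩)).2.2 rfl

/-- The path-weights coincide or both have rank at least `n`. -/
def AgreeBelow (A : R.Topology V) (n : ℕ) (x y : S) : Prop :=
  x = y ∨ n ≤ rank A x ∧ n ≤ rank A y

theorem AgreeBelow.symm {A : R.Topology V} {n : ℕ} {x y : S} (h : AgreeBelow A n x y) :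
    AgreeBelow A n y x :=
  h.imp Eq.symm And.symm

theorem AgreeBelow.eq {A : R.Topology V} {n : ℕ} {x y : S} (h : AgreeBelow A n x y)
    (hn : (consistentWeights A).ncard < n) : x = y :=
  h.resolve_right fun h' => absurd (h'.1.trans (rank_le A x)) (not_le.2 hn)

/-- If the new entries differ, the better one is neither `∞` nor the identity entry, so it extends
some valid `X k j`. There `X` and `Y` differ, or the other side would do as well. Thus `X k j` has
rank at least `n`, and its extension is strictly worse. -/
theorem IsPathAlgebra.iter_agreeBelow (hR : R.IsRoutingAlgebra) (hP : R.IsPathAlgebra path)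
    (hI : R.IsIncreasing) (A : R.Topology V) {n : ℕ} {X Y : R.State V}
    (hX : ∀ i j, X i j ∈ consistentWeights A) (hY : ∀ i j, Y i j ∈ consistentWeights A)
    (h : ∀ i j, AgreeBelow A n (X i j) (Y i j)) (i j : V) :
    AgreeBelow A (n + 1) (R.iter A X i j) (R.iter A Y i j) := by
  wlog hle : R.Pref (R.iter A X i j) (R.iter A Y i j) generalizing X Y with H
  · exact (H hY hX (fun i j => (h i j).symm)
      ((hR.pref_total _ _).resolve_left hle)).symm
  by_cases heq : R.iter A X i j = R.iter A Y i j
  · exact Or.inl heq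
  have hn : n + 1 ≤ rank A (R.iter A X i j) := by
    have hnot : ¬ R.Pref (R.iter A Y i j) (R.iter A X i j) := fun h' =>
      heq (hR.pref_antisymm hle h')
    rcases hR.iter_cases A X i j with hx | hx | ⟨k, hx⟩
    · exact absurd (hx ▸ hR.pref_inf _) hnot
    · exact absurd (hx ▸ hR.iter_pref_idMatrix A Y i j) hnot
    · rcases h k j with hk | ⟨hk, -⟩
      · exact absurd (hx ▸ hk ▸ hR.iter_pref_apply A Y i j k) hnot
      · have hinf : X k j ≠ R.inf := fun hinf => by
          rw [hinf, hR.inf_fixed _ _ _ (A i k).2] at hx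
          exact hnot (hx ▸ hR.pref_inf _)
        rw [hx]
        exact Nat.succ_le_of_lt (hk.trans_lt (hR.rank_lt A (hX k j)
          (hI _ _ _ (A i k).2 _) (hP.apply_ne_self (A i k).2 hinf).symm))
  exact Or.inr ⟨hn, hn.trans
    (hR.rank_lt A (hP.iter_mem_consistentWeights hR A hX i j) hle heq).le⟩

theorem IsPathAlgebra.exists_fixedPoint (hR : R.IsRoutingAlgebra) (hP : R.IsPathAlgebra path)
    (hI : R.IsIncreasing) (A : R.Topology V) :
    ∃ X : R.State V, R.iter A X = X ∧ ∀ i j, X i j ∈ consistentWeights A := by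
  have hmem : ∀ n i j, (R.iter A)^[n] (R.idMatrix V) i j ∈ consistentWeights A := by
    intro n
    induction n with
    | zero => exact idMatrix_mem_consistentWeights A
    | succ n ih =>
      rw [Function.iterate_succ_apply']
      exact hP.iter_mem_consistentWeights hR A ih
  have hagree : ∀ n i j, AgreeBelow A n ((R.iter A)^[n + 1] (R.idMatrix V) i j)
      ((R.iter A)^[n] (R.idMatrix V) i j) := by
    intro n
    induction n with
    | zero => exact fun i j => Or.inr ⟨Nat.zero_le _, Nat.zero_le _⟩
    | succ n ih =>
      rw [Function.iterate_succ_apply' _ (n + 1), Function.iterate_succ_apply' _ n]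
      rw [Function.iterate_succ_apply' _ n] at ih
      refine hP.iter_agreeBelow hR hI A ?_ (hmem n) ih
      rw [← Function.iterate_succ_apply' (R.iter A) n]
      exact hmem (n + 1)
  refine ⟨(R.iter A)^[(consistentWeights A).ncard + 1] (R.idMatrix V), ?_, hmem _⟩
  rw [← Function.iterate_succ_apply' (R.iter A)]
  funext i j
  exact (hagree _ i j).eq (Nat.lt_succ_self _)

/-- A sequence of boxes that shrinks to `Xs`: the first `V.card + 1` steps remove the inconsistent
path-weights, the later ones make the entries agree with `Xs` up to a growing rank. -/
def convergenceBox (path : S → RoutePath 𝕍) (A : R.Topology V) (Xs : R.State V) (n : ℕ)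
    (i j : V) : Set S :=
  {x | x ∈ nearlyConsistent path A n ∧ AgreeBelow A (n - (V.card + 1)) x (Xs i j)}

theorem IsPathAlgebra.iter_mem_convergenceBox (hR : R.IsRoutingAlgebra)
    (hP : R.IsPathAlgebra path) (hI : R.IsIncreasing) (A : R.Topology V) {Xs : R.State V}
    (hfix : R.iter A Xs = Xs) (hXs : ∀ i j, Xs i j ∈ consistentWeights A) (n : ℕ)
    (Y : R.State V) (hY : ∀ i j, Y i j ∈ convergenceBox path A Xs n i j) (i j : V) :
    R.iter A Y i j ∈ convergenceBox path A Xs (n + 1) i j := by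
  refine ⟨hP.iter_mem_nearlyConsistent hR A (fun i j => (hY i j).1) i j, ?_⟩
  -- While flushing lasts, truncated subtraction gives `0` and agreement is vacuous.
  rcases le_or_gt n V.card with hn | hn
  · rw [Nat.sub_eq_zero_of_le (by omega)]
    exact Or.inr ⟨Nat.zero_le _, Nat.zero_le _⟩
  · have hYC : ∀ i j, Y i j ∈ consistentWeights A := fun i j =>
      nearlyConsistent_of_card_lt (path := path) hn ▸ (hY i j).1
    have := hP.iter_agreeBelow hR hI A hYC hXs (fun i j => (hY i j).2) i j
    rw [hfix] at this
    rwa [Nat.succ_sub hn]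

end Contraction

end RawRoutingAlgebra

/-! ### Convergence -/

theorem mainTheorem3 {𝕍 : Type*} {S : Type*} (R : RawRoutingAlgebra 𝕍 S) (path : S → RoutePath 𝕍)
    (hR : R.IsRoutingAlgebra) (hP : R.IsPathAlgebra path) (hI : R.IsIncreasing)
    (V : Finset 𝕍) (N : R.Network V) : R.AlwaysConvergent N := by
  choose Xs hfix hXs using fun (e : ℕ) (p : Set V) =>
    hP.exists_fixedPoint hR hI (R.partTopology N e p)
  -- Flushing takes `|V| + 1` rounds and exceeding every rank `|C| + 1`; the further `+ 1` below
  -- pays for a pseudocycle at time `0`.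
  let K : ℕ → Set V → ℕ := fun e p =>
    (RawRoutingAlgebra.consistentWeights (R.partTopology N e p)).ncard + 1 + (V.card + 1)
  refine ⟨Xs, fun e p => K e p + 1, fun e p _ => hfix e p, ?_⟩
  intro X ψ t₁ t₂ _ hc t₃ ht hη
  funext i j
  have hbox := RawRoutingAlgebra.asyncState_mem_of_containsPseudocycles (N := N) hR X
    (RawRoutingAlgebra.convergenceBox path (R.partTopology N (ψ.η t₁) (ψ.ρ t₁))
      (Xs (ψ.η t₁) (ψ.ρ t₁))) ?_
    (hP.iter_mem_convergenceBox hR hI _ (hfix _ _) (hXs _ _)) hc t₃ ht hη i j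
  · exact hbox.2.eq (by simp only [K]; omega)
  · intro i j
    refine Set.eq_univ_of_forall fun x => ⟨?_, ?_⟩
    · rw [hP.nearlyConsistent_zero]
      trivial
    · rw [Nat.zero_sub]
      exact Or.inr ⟨Nat.zero_le _, Nat.zero_le _⟩
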